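/- Let $N\ge 1$ and $M\ge 0$ be integers and let $\rho_1,\rho_I>0$. Let $\mathbf h_1\in\mathbb C^N$ be a random vector and let $\mathbf H_I=[\mathbf h_{I1},\dots,\mathbf h_{IM}]$ be a random $N\times M$ complex matrix such that all entries of $\mathbf h_1$ and of $\mathbf H_I$ are jointly independent and each is circular complex Gaussian $\mathcal{CN}(0,1)$. Let $\mathbf R=\mathbf H_I\mathbf H_I^\dagger+\frac1{\rho_I}\mathbf I$, let $\mathbf w_1=\mathbf h_1^\dagger\bigl(\mathbf h_1\mathbf h_1^\dagger+\mathbf R\bigr)^{-1}$ be the MMSE combining vector, and let $$Z=\frac{|\mathbf w_1\mathbf h_1|^2\rho_1}{\sum_{i=1}^M|\mathbf w_1\mathbf h_{Ii}|^2\rho_I+\|\mathbf w_1\|^2}$$ be its output SINR (with $Z=0$ if $\mathbf h_1=0$). Then $Z$ is a random variable, $Z=\frac{\rho_1}{\rho_I}\,\mathbf h_1^\dagger\mathbf R^{-1}\mathbf h_1$, and its c.d.f. $F_Z$ satisfies $F_Z(z)=0$ for $z<0$ and, for every $z\ge 0$, $$F_Z(z)=1-\frac{\Gamma\left(N,\frac{z}{\rho_1}\right)}{\Gamma(N)}+\Gamma(M+1)\,e^{-z/\rho_1}\left(\frac{z}{\rho_1}\right)^N\sum_{m=m_1}^{N}\frac{\rho_I^{N-m+1}\;{}_2F_1\left(M+1,N-m+1;N-m+2;-\frac{\rho_I}{\rho_1}z\right)}{\Gamma(m)\,\Gamma(N-m+2)\,\Gamma(m-N+M)},$$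 where $m_1=\max(0,N-M)+1$. Here $\Gamma(a,x)=\int_x^\infty t^{a-1}e^{-t}\,dt$ is the upper incomplete gamma function, and ${}_2F_1(a,b;c;x)$, for real $x<1$, is the Gauss hypergeometric function, that is, the analytic continuation to $(-\infty,1)$ of the hypergeometric series, which converges for $|x|<1$. (If $M=0$ the sum is empty.) -/

import Mathlib

open MeasureTheory ProbabilityTheory
open scoped Matrix

noncomputable section

/-- The law `CN(0,1)` of a circular complex Gaussian variable with zero mean and unit variance:
independent real and imaginary parts, each a centred real Gaussian of variance `1/2`. -/
def complexGaussian : Measure ℂ :=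
  ((gaussianReal 0 (1 / 2)).prod (gaussianReal 0 (1 / 2))).map
    (fun p : ℝ × ℝ => (p.1 : ℂ) + (p.2 : ℂ) * Complex.I)

/-- The upper incomplete gamma function `Γ(a, x) = ∫_x^∞ t^(a-1) e^(-t) dt`. -/
def upperIncompleteGamma (a x : ℝ) : ℝ :=
  ∫ t in Set.Ioi x, t ^ (a - 1) * Real.exp (-t)

/-- `F` is the analytic continuation to the half-line `(-∞, 1)` of the Gauss hypergeometric series
with real parameters `a, b, c`, a series that converges on `(-1, 1)` only. Such an `F` is unique on
`(-∞, 1)`, and is there the principal branch of the Gauss hypergeometric function. -/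
def IsGaussHypergeometric (a b c : ℝ) (F : ℝ → ℝ) : Prop :=
  AnalyticOnNhd ℝ F (Set.Iio 1) ∧
    ∀ x : ℝ, |x| < 1 → F x = ordinaryHypergeometric a b c x

open Classical in
/-- The Gauss hypergeometric function `₂F₁(a, b; c; x)` at a real argument `x < 1`: the analytic
continuation of the hypergeometric series. -/
def gaussHypergeometric (a b c x : ℝ) : ℝ :=
  if h : ∃ F : ℝ → ℝ, IsGaussHypergeometric a b c F then h.choose x else 0

theorem IsGaussHypergeometric.eqOn {a b c : ℝ} {F G : ℝ → ℝ}
    (hF : IsGaussHypergeometric a b c F) (hG : IsGaussHypergeometric a b c G) :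
    Set.EqOn F G (Set.Iio 1) := by
  refine hF.1.eqOn_of_preconnected_of_eventuallyEq hG.1 isPreconnected_Iio
    (z₀ := 0) (by simp) ?_
  filter_upwards [Metric.ball_mem_nhds (0 : ℝ) one_pos] with x hx
  have hx' : |x| < 1 := by simpa using hx
  rw [hF.2 x hx', hG.2 x hx']

theorem IsGaussHypergeometric.eq_gaussHypergeometric {a b c : ℝ} {F : ℝ → ℝ}
    (hF : IsGaussHypergeometric a b c F) {x : ℝ} (hx : x < 1) :
    gaussHypergeometric a b c x = F x := by
  have h : ∃ F : ℝ → ℝ, IsGaussHypergeometric a b c F := ⟨F, hF⟩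
  rw [gaussHypergeometric, dif_pos h]
  exact h.choose_spec.eqOn hF hx

/-- The matrix `R = H_I H_I† + (1/ρ_I) I`; the columns of `H_I` are the interferers' channels. -/
def interferenceMatrix {N M : ℕ} (ρI : ℝ) (H : Matrix (Fin N) (Fin M) ℂ) :
    Matrix (Fin N) (Fin N) ℂ :=
  H * Hᴴ + ((1 / ρI : ℝ) : ℂ) • (1 : Matrix (Fin N) (Fin N) ℂ)

/-- The MMSE combining (row) vector `w₁ = h₁† (h₁ h₁† + H_I H_I† + (1/ρ_I) I)⁻¹`. -/
def mmseCombiner {N M : ℕ} (ρI : ℝ) (h : Fin N → ℂ) (H : Matrix (Fin N) (Fin M) ℂ) :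
    Fin N → ℂ :=
  star h ᵥ* (Matrix.vecMulVec h (star h) + H * Hᴴ
    + ((1 / ρI : ℝ) : ℂ) • (1 : Matrix (Fin N) (Fin N) ℂ))⁻¹

/-- The output SINR `|w₁ h₁|² ρ₁ / (∑ᵢ |w₁ h_{Ii}|² ρ_I + ‖w₁‖²)` of the MMSE combiner. -/
def mmseSINR {N M : ℕ} (ρ1 ρI : ℝ) (h : Fin N → ℂ) (H : Matrix (Fin N) (Fin M) ℂ) : ℝ :=
  ‖mmseCombiner ρI h H ⬝ᵥ h‖ ^ 2 * ρ1 /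
    ((∑ i : Fin M, ‖mmseCombiner ρI h H ⬝ᵥ (fun n => H n i)‖ ^ 2 * ρI)
      + ∑ n : Fin N, ‖mmseCombiner ρI h H n‖ ^ 2)

end

/-! By the Sherman–Morrison identity the SINR is (ρ1/ρI)·Q with Q = h†(HH† + cI)⁻¹h and c = 1/ρI
(`mmseSINR_eq`). It remains to find the law of Q = Q_{N,M} for N antennas and M interferers.

The law of a Gaussian matrix is unitarily invariant, so h may be rotated to ‖h‖e₀. Then Q is ‖h‖²
times the corner entry of the inverse, and a Schur complement expresses that entry by a form of the
same kind for the conjugate-transposed problem (`gramForm_single`). Hence Q_{N+1,M} has the law of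
G/(c(1 + Q_{M,N})) with G an independent gamma variable of shape N+1 (`channelLaw_lt_channelForm`).
The total N+M drops by one, so induction determines the law; no eigenvalue density is needed.

The solution of the recursion is `survival`: P(Q > y) = P(X + Y < N), where X is Poisson of mean cy
and Y is an independent binomial count of M trials with odds y. That it satisfies the recursion is
`survival_succ_eq`, a computation with gamma integrals.

Conditioning on X = k gives terms 1 - P(Y ≥ N-k). The ones add up to the incomplete gamma quotient.
Each tail P(Y ≥ N-k) is a multiple of a ₂F₁, because at these integer parameters ₂F₁ is a rational
function with its only pole at 1 (`isGaussHypergeometric_closedForm`). -/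

noncomputable section

/-! ### The quadratic form of a regularised Gram matrix -/

section LinearAlgebra

variable {α β : Type*} [DecidableEq α] [Fintype β]

/-- The regularised Gram matrix `K K† + c I`. -/
def regGram (c : ℝ) (K : Matrix α β ℂ) : Matrix α α ℂ :=
  K * Kᴴ + (c : ℂ) • (1 : Matrix α α ℂ)

theorem isHermitian_regGram (c : ℝ) (K : Matrix α β ℂ) : (regGram c K).IsHermitian := by
  simp [regGram, Matrix.IsHermitian, Matrix.conjTranspose_smul]

theorem continuous_regGram (c : ℝ) : Continuous (regGram c : Matrix α β ℂ → Matrix α α ℂ) := by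
  unfold regGram; fun_prop

variable [Fintype α]

/-- The quadratic form `h† (K K† + c I)⁻¹ h`. -/
def gramForm (c : ℝ) (h : α → ℂ) (K : Matrix α β ℂ) : ℝ :=
  (star h ⬝ᵥ ((regGram c K)⁻¹ *ᵥ h)).re

open scoped ComplexOrder in
theorem regGram_posDef {c : ℝ} (hc : 0 < c) (K : Matrix α β ℂ) : (regGram c K).PosDef := by
  refine Matrix.PosDef.posSemidef_add (Matrix.posSemidef_self_mul_conjTranspose K) ?_
  exact Matrix.PosDef.one.smul (by exact_mod_cast hc)

open scoped ComplexOrder in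
theorem isUnit_regGram {c : ℝ} (hc : 0 < c) (K : Matrix α β ℂ) : IsUnit (regGram c K) :=
  (regGram_posDef hc K).isUnit

theorem isUnit_det_regGram {c : ℝ} (hc : 0 < c) (K : Matrix α β ℂ) :
    IsUnit (regGram c K).det :=
  (Matrix.isUnit_iff_isUnit_det _).1 (isUnit_regGram hc K)

theorem regGram_mulVec (c : ℝ) (K : Matrix α β ℂ) (x : α → ℂ) :
    regGram c K *ᵥ x = K *ᵥ (Kᴴ *ᵥ x) + (c : ℂ) • x := by
  simp [regGram, Matrix.add_mulVec, Matrix.smul_mulVec]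

theorem inv_regGram_mulVec_eq {c : ℝ} (hc : 0 < c) {K : Matrix α β ℂ} {h x : α → ℂ}
    (hx : regGram c K *ᵥ x = h) : (regGram c K)⁻¹ *ᵥ h = x := by
  rw [← hx, Matrix.mulVec_mulVec, Matrix.nonsing_inv_mul _ (isUnit_det_regGram hc K),
    Matrix.one_mulVec]

theorem regGram_mulVec_inv_mulVec {c : ℝ} (hc : 0 < c) (K : Matrix α β ℂ) (h : α → ℂ) :
    regGram c K *ᵥ ((regGram c K)⁻¹ *ᵥ h) = h := by
  rw [Matrix.mulVec_mulVec, Matrix.mul_nonsing_inv _ (isUnit_det_regGram hc K),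
    Matrix.one_mulVec]

theorem gramForm_eq_of_mulVec_eq {c : ℝ} (hc : 0 < c) {K : Matrix α β ℂ} {h x : α → ℂ}
    (hx : regGram c K *ᵥ x = h) : gramForm c h K = (star h ⬝ᵥ x).re := by
  rw [gramForm, inv_regGram_mulVec_eq hc hx]

open scoped ComplexOrder in
theorem gramForm_nonneg {c : ℝ} (hc : 0 < c) (h : α → ℂ) (K : Matrix α β ℂ) :
    0 ≤ gramForm c h K :=
  (regGram_posDef hc K).inv.posSemidef.re_dotProduct_nonneg h

theorem ofReal_gramForm (c : ℝ) (h : α → ℂ) (K : Matrix α β ℂ) :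
    (gramForm c h K : ℂ) = star h ⬝ᵥ ((regGram c K)⁻¹ *ᵥ h) := by
  have := (isHermitian_regGram c K).inv.im_star_dotProduct_mulVec_self h
  exact Complex.ext (by simp [gramForm]) (by simpa using this.symm)

theorem gramForm_smul {c : ℝ} (a : ℂ) (h : α → ℂ) (K : Matrix α β ℂ) :
    gramForm c (a • h) K = ‖a‖ ^ 2 * gramForm c h K := by
  have : ((gramForm c (a • h) K : ℝ) : ℂ) = ((‖a‖ ^ 2 * gramForm c h K : ℝ) : ℂ) := by
    push_cast
    rw [ofReal_gramForm, ofReal_gramForm, star_smul, Matrix.mulVec_smul, smul_dotProduct,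
      dotProduct_smul, smul_eq_mul, smul_eq_mul, ← mul_assoc, ← Complex.conj_mul']
    rfl
  exact_mod_cast this

theorem regGram_unitary_mul {c : ℝ} {U : Matrix α α ℂ} (hU : U ∈ Matrix.unitaryGroup α ℂ)
    (K : Matrix α β ℂ) : regGram c (U * K) = U * regGram c K * Uᴴ := by
  have h1 : U * Uᴴ = 1 := Matrix.mem_unitaryGroup_iff.1 hU
  simp [regGram, Matrix.mul_add, Matrix.add_mul, Matrix.mul_assoc, h1]

theorem gramForm_unitary_mul {c : ℝ} (hc : 0 < c) {U : Matrix α α ℂ}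
    (hU : U ∈ Matrix.unitaryGroup α ℂ) (h : α → ℂ) (K : Matrix α β ℂ) :
    gramForm c (U *ᵥ h) (U * K) = gramForm c h K := by
  have h1 : Uᴴ * U = 1 := Matrix.mem_unitaryGroup_iff'.1 hU
  have key : regGram c (U * K) *ᵥ (U *ᵥ ((regGram c K)⁻¹ *ᵥ h)) = U *ᵥ h := by
    rw [regGram_unitary_mul hU, Matrix.mulVec_mulVec, Matrix.mul_assoc, h1, Matrix.mul_one,
      ← Matrix.mulVec_mulVec, regGram_mulVec_inv_mulVec hc]
  rw [gramForm_eq_of_mulVec_eq hc key, Matrix.star_mulVec, Matrix.dotProduct_mulVec,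
    Matrix.vecMul_vecMul, h1, Matrix.vecMul_one, gramForm]

theorem continuous_gramForm {c : ℝ} (hc : 0 < c) :
    Continuous fun p : (α → ℂ) × Matrix α β ℂ => gramForm c p.1 p.2 := by
  have hR : Continuous fun p : (α → ℂ) × Matrix α β ℂ => regGram c p.2 :=
    (continuous_regGram c).comp continuous_snd
  have hI : Continuous fun p : (α → ℂ) × Matrix α β ℂ => (regGram c p.2)⁻¹ := by
    simp only [Matrix.inv_def, Ring.inverse_eq_inv]
    exact (hR.matrix_det.inv₀ fun p => (isUnit_det_regGram hc p.2).ne_zero).smul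
      hR.matrix_adjugate
  unfold gramForm
  exact Complex.continuous_re.comp
    (continuous_fst.star.dotProduct (hI.matrix_mulVec continuous_fst))

end LinearAlgebra

/-! ### Rotation to an axis and the Schur complement -/

/-- Every vector can be rotated onto the first coordinate axis. -/
theorem exists_unitary_mulVec_eq_single {n : ℕ} (h : Fin (n + 1) → ℂ) :
    ∃ U ∈ Matrix.unitaryGroup (Fin (n + 1)) ℂ,
      U *ᵥ h = ((√(∑ i, ‖h i‖ ^ 2) : ℝ) : ℂ) • Pi.single 0 1 := by
  classical
  obtain hz | hz := eq_or_ne h 0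
  · refine ⟨1, one_mem _, by simp [hz]⟩
  set v : EuclideanSpace ℂ (Fin (n + 1)) := WithLp.toLp 2 h with hv
  have hv0 : v ≠ 0 := by
    intro h0; apply hz; simpa [hv] using h0
  have hnv : ‖v‖ = √(∑ i, ‖h i‖ ^ 2) := by simp [hv, EuclideanSpace.norm_eq]
  -- Only the value at index 0 matters: the family is required to be orthonormal on {0} alone, and
  -- is extended from there to a basis.
  set u : Fin (n + 1) → EuclideanSpace ℂ (Fin (n + 1)) := fun _ => ((‖v‖ : ℂ)⁻¹) • v
  have hu : ‖((‖v‖ : ℂ)⁻¹) • v‖ = 1 := norm_smul_inv_norm hv0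
  obtain ⟨b, hb⟩ := Orthonormal.exists_orthonormalBasis_extension_of_card_eq (𝕜 := ℂ)
    (ι := Fin (n + 1)) (by simp) (v := u) (s := {0}) (by
      constructor
      · intro i; simpa [u] using hu
      · intro i j hij; exact (hij (Subsingleton.elim _ _)).elim)
  have hb0 : v = (‖v‖ : ℂ) • b 0 := by
    rw [hb 0 rfl]; simp only [u]
    rw [smul_smul, mul_inv_cancel₀ (by simpa using hv0), one_smul]
  set e := EuclideanSpace.basisFun (Fin (n + 1)) ℂ
  refine ⟨b.toBasis.toMatrix e.toBasis, ?_, ?_⟩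
  · simpa using b.toMatrix_orthonormalBasis_mem_unitary e
  · have h1 : h = e.toBasis.repr v := by ext i; simp [e, hv]
    conv_lhs => rw [h1, Module.Basis.toMatrix_mulVec_repr]
    rw [← hnv]
    ext i
    rw [OrthonormalBasis.coe_toBasis_repr_apply, hb0, map_smul, b.repr_self, ← hb0]
    simp [Pi.single_apply]

/-- The quadratic form at the first basis vector reduces, through a Schur complement, to the
quadratic form of the transposed problem with one dimension less. -/
theorem gramForm_single {n M : ℕ} {c : ℝ} (hc : 0 < c) (K : Matrix (Fin (n + 1)) (Fin M) ℂ) :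
    gramForm c (Pi.single 0 1) K =
      (c * (1 + gramForm c (fun i => star (K 0 i))
        (Matrix.of fun i (j : Fin n) => star (K j.succ i))))⁻¹ := by
  set g : Fin M → ℂ := fun i => star (K 0 i) with hg
  set A : Matrix (Fin M) (Fin n) ℂ := Matrix.of fun i j => star (K j.succ i) with hA
  set q := gramForm c g A
  have hq : 0 ≤ q := gramForm_nonneg hc g A
  set v := (regGram c A)⁻¹ *ᵥ g with hv
  have hRv : A *ᵥ (Aᴴ *ᵥ v) + (c : ℂ) • v = g := by
    rw [← regGram_mulVec, hv, regGram_mulVec_inv_mulVec hc]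
  have hqv : (q : ℂ) = star g ⬝ᵥ v := ofReal_gramForm c g A
  -- Up to scaling, y is the first column of the inverse: the lower block is chosen so that Kᴴy =
  -- c·v, which makes all coordinates of the image but the first vanish.
  set y : Fin (n + 1) → ℂ := Fin.cons 1 (-(Aᴴ *ᵥ v)) with hy
  have hKy : Kᴴ *ᵥ y = (c : ℂ) • v := by
    rw [eq_sub_of_add_eq' hRv]
    ext i
    rw [Matrix.mulVec, dotProduct, Fin.sum_univ_succ]
    simp only [hy, Fin.cons_zero, Fin.cons_succ, Pi.sub_apply, Pi.neg_apply, mul_neg,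
      Finset.sum_neg_distrib, mul_one, ← sub_eq_add_neg]
    rfl
  have hRy : regGram c K *ᵥ y = ((c * (1 + q) : ℝ) : ℂ) • Pi.single 0 1 := by
    rw [regGram_mulVec, hKy, Matrix.mulVec_smul, ← smul_add]
    ext j
    refine Fin.cases ?_ (fun j => ?_) j
    · push_cast
      rw [hqv]
      simp [Matrix.mulVec, dotProduct, hy, hg]
      left; ring
    · simp [Matrix.mulVec, dotProduct, hy, hA]
  have hpos : 0 < c * (1 + q) := by positivity
  have hx : regGram c K *ᵥ (((c * (1 + q))⁻¹ : ℝ) • y) = Pi.single 0 1 := by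
    rw [Matrix.mulVec_smul, hRy, Complex.coe_smul, smul_smul, inv_mul_cancel₀ hpos.ne', one_smul]
  rw [gramForm_eq_of_mulVec_eq hc hx, ← Pi.single_star, single_dotProduct]
  simp only [Pi.smul_apply, hy, Fin.cons_zero, star_one, one_mul, Complex.smul_re,
    Complex.one_re, smul_eq_mul, mul_one]

/-! ### The SINR as a quadratic form -/

theorem dotProduct_star_self_eq_sum_norm {ι : Type*} [Fintype ι] (x : ι → ℂ) :
    x ⬝ᵥ star x = ((∑ i, ‖x i‖ ^ 2 : ℝ) : ℂ) := by
  simp [dotProduct, Complex.mul_conj']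

open scoped ComplexOrder in
-- Sherman–Morrison: the rank-one term hh† only rescales h†R⁻¹, by 1/(1 + q). It is checked by
-- multiplying back.
theorem mmseCombiner_eq {N M : ℕ} {ρI : ℝ} (hρI : 0 < ρI) (h : Fin N → ℂ)
    (H : Matrix (Fin N) (Fin M) ℂ) :
    mmseCombiner ρI h H =
      ((1 + gramForm (1 / ρI) h H : ℝ) : ℂ)⁻¹ • (star h ᵥ* (regGram (1 / ρI) H)⁻¹) := by
  have hc : 0 < 1 / ρI := by positivity
  have hq := gramForm_nonneg hc h H
  have hq1 : ((1 + gramForm (1 / ρI) h H : ℝ) : ℂ) ≠ 0 := by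
    exact_mod_cast (by positivity : (1 + gramForm (1 / ρI) h H) ≠ 0)
  have hB : IsUnit (Matrix.vecMulVec h (star h) + regGram (1 / ρI) H).det :=
    (Matrix.isUnit_iff_isUnit_det _).1
      (Matrix.PosDef.posSemidef_add (Matrix.posSemidef_vecMulVec_self_star h)
        (regGram_posDef hc H)).isUnit
  have key : (((1 + gramForm (1 / ρI) h H : ℝ) : ℂ)⁻¹ • (star h ᵥ* (regGram (1 / ρI) H)⁻¹)) ᵥ*
      (Matrix.vecMulVec h (star h) + regGram (1 / ρI) H) = star h := by
    rw [Matrix.smul_vecMul, Matrix.vecMul_add, Matrix.vecMul_vecMulVec, Matrix.vecMul_vecMul,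
      Matrix.nonsing_inv_mul _ (isUnit_det_regGram hc H), Matrix.vecMul_one,
      ← Matrix.dotProduct_mulVec, ← ofReal_gramForm, inv_smul_eq_iff₀ hq1]
    push_cast
    rw [add_smul, one_smul, add_comm]
  have hdef : mmseCombiner ρI h H =
      star h ᵥ* (Matrix.vecMulVec h (star h) + regGram (1 / ρI) H)⁻¹ := by
    rw [mmseCombiner, regGram, add_assoc]
  have key2 := congrArg
    (· ᵥ* (Matrix.vecMulVec h (star h) + regGram (1 / ρI) H)⁻¹) key
  rw [Matrix.vecMul_vecMul, Matrix.mul_nonsing_inv _ hB, Matrix.vecMul_one] at key2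
  rw [hdef, ← key2]

/-- The output SINR of the MMSE combiner is a quadratic form in the desired channel. -/
theorem mmseSINR_eq {N M : ℕ} (ρ1 : ℝ) {ρI : ℝ} (hρI : 0 < ρI) (h : Fin N → ℂ)
    (H : Matrix (Fin N) (Fin M) ℂ) :
    mmseSINR ρ1 ρI h H = ρ1 / ρI * gramForm (1 / ρI) h H := by
  have hc : 0 < 1 / ρI := by positivity
  set q := gramForm (1 / ρI) h H with hqdef
  have hq : 0 ≤ q := gramForm_nonneg hc h H
  set w := mmseCombiner ρI h H with hw
  have hwe : w = ((1 + q : ℝ) : ℂ)⁻¹ • (star h ᵥ* (regGram (1 / ρI) H)⁻¹) :=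
    mmseCombiner_eq hρI h H
  have hwh : w ⬝ᵥ h = ((q / (1 + q) : ℝ) : ℂ) := by
    rw [hwe, smul_dotProduct, ← Matrix.dotProduct_mulVec, ← ofReal_gramForm, smul_eq_mul]
    rw [← hqdef, Complex.ofReal_div, div_eq_inv_mul]
  have hwR : w ᵥ* regGram (1 / ρI) H = ((1 + q : ℝ) : ℂ)⁻¹ • star h := by
    rw [hwe, Matrix.smul_vecMul, Matrix.vecMul_vecMul,
      Matrix.nonsing_inv_mul _ (isUnit_det_regGram hc H), Matrix.vecMul_one]
  -- Interference plus noise, divided by ρI, is wRw†, and wR is a multiple of h†.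
  have hD : (w ᵥ* H) ⬝ᵥ star (w ᵥ* H) + ((1 / ρI : ℝ) : ℂ) * (w ⬝ᵥ star w) =
      ((q / (1 + q) ^ 2 : ℝ) : ℂ) := by
    have h1 : (w ᵥ* regGram (1 / ρI) H) ⬝ᵥ star w =
        (w ᵥ* H) ⬝ᵥ star (w ᵥ* H) + ((1 / ρI : ℝ) : ℂ) * (w ⬝ᵥ star w) := by
      rw [regGram, Matrix.vecMul_add, ← Matrix.vecMul_vecMul, add_dotProduct, Matrix.star_vecMul,
        Matrix.dotProduct_mulVec, Matrix.vecMul_smul, Matrix.vecMul_one, smul_dotProduct,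
        smul_eq_mul]
    have h2 : star h ⬝ᵥ star w = ((q / (1 + q) : ℝ) : ℂ) := by
      rw [Matrix.star_dotProduct_star, hwh]
      exact Complex.conj_ofReal _
    rw [← h1, hwR, smul_dotProduct, h2, smul_eq_mul, ← Complex.ofReal_inv, ← Complex.ofReal_mul]
    congr 1
    field_simp
  rw [dotProduct_star_self_eq_sum_norm, dotProduct_star_self_eq_sum_norm] at hD
  have hD' : (∑ i, ‖(w ᵥ* H) i‖ ^ 2) + 1 / ρI * ∑ n, ‖w n‖ ^ 2 = q / (1 + q) ^ 2 := by
    exact_mod_cast hD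
  have hden : (∑ i : Fin M, ‖w ⬝ᵥ (fun n => H n i)‖ ^ 2 * ρI) + ∑ n : Fin N, ‖w n‖ ^ 2 =
      ρI * (q / (1 + q) ^ 2) := by
    rw [← hD', ← Finset.sum_mul, mul_add, ← mul_assoc, mul_one_div_cancel hρI.ne', one_mul,
      mul_comm]
    rfl
  have hnum : ‖w ⬝ᵥ h‖ ^ 2 = (q / (1 + q)) ^ 2 := by
    rw [hwh, Complex.norm_real, Real.norm_eq_abs, sq_abs]
  rw [mmseSINR, ← hw, hden, hnum]
  -- When q = 0 the SINR is 0/0, which is 0 by convention and agrees with the right-hand side.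
  obtain h0 | h0 := hq.eq_or_lt
  · simp [← h0]
  · field_simp

/-! ### Densities and isometry invariance of Gaussian families -/

section Density

theorem map_withDensity_comp {α β : Type*} [MeasurableSpace α] [MeasurableSpace β]
    (μ : Measure α) {g : α → β} {f : β → ENNReal} (hg : Measurable g) (hf : Measurable f) :
    (μ.withDensity fun x => f (g x)).map g = (μ.map g).withDensity f := by
  ext s hs
  rw [Measure.map_apply hg hs, withDensity_apply _ (hg hs), withDensity_apply _ hs,
    setLIntegral_map hs hf hg]

theorem pi_withDensity {ι α : Type*} [Fintype ι] [MeasurableSpace α] (μ : Measure α)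
    [SigmaFinite μ] {f : α → ℝ} (hf : Integrable f μ) (hf0 : ∀ x, 0 ≤ f x) :
    Measure.pi (fun _ : ι => μ.withDensity fun x => ENNReal.ofReal (f x)) =
      (Measure.pi fun _ : ι => μ).withDensity fun x => ENNReal.ofReal (∏ i, f (x i)) := by
  refine Measure.pi_eq fun s hs => ?_
  rw [withDensity_apply _ (MeasurableSet.univ_pi hs), Measure.restrict_pi_pi,
    ← ofReal_integral_eq_lintegral_ofReal, integral_fintype_prod_eq_prod (fun _ => f),
    ENNReal.ofReal_prod_of_nonneg]
  · refine Finset.prod_congr rfl fun i _ => ?_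
    rw [withDensity_apply _ (hs i), ofReal_integral_eq_lintegral_ofReal hf.restrict
      (ae_of_all _ hf0)]
  · exact fun i _ => integral_nonneg hf0
  · exact Integrable.fintype_prod (f := fun _ => f) fun i => hf.restrict
  · exact ae_of_all _ fun x => Finset.prod_nonneg fun i _ => hf0 _

end Density

/-- The density of the law `CN(0,1)`. -/
def complexGaussianPDF (z : ℂ) : ℝ := Real.pi⁻¹ * Real.exp (-‖z‖ ^ 2)

theorem complexGaussianPDF_nonneg (z : ℂ) : 0 ≤ complexGaussianPDF z := by
  unfold complexGaussianPDF; positivity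

theorem continuous_complexGaussianPDF : Continuous complexGaussianPDF := by
  unfold complexGaussianPDF; fun_prop

theorem complexGaussian_eq_withDensity :
    complexGaussian = volume.withDensity fun z => ENNReal.ofReal (complexGaussianPDF z) := by
  have hg : (fun p : ℝ × ℝ => (p.1 : ℂ) + (p.2 : ℂ) * Complex.I) =
      Complex.measurableEquivRealProd.symm := by
    ext p : 1
    exact (Complex.mk_eq_add_mul_I _ _).symm
  have hv : (1 / 2 : NNReal) ≠ 0 := by norm_num
  rw [complexGaussian, gaussianReal_of_var_ne_zero _ hv, prod_withDensity
    (measurable_gaussianPDF _ _) (measurable_gaussianPDF _ _), hg,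
    ← (Complex.volume_preserving_equiv_real_prod.symm).map_eq, ← Measure.volume_eq_prod,
    ← map_withDensity_comp _ Complex.measurableEquivRealProd.symm.measurable
      (by exact continuous_complexGaussianPDF.measurable.ennreal_ofReal)]
  congr 2
  ext p
  rw [gaussianPDF, gaussianPDF, ← ENNReal.ofReal_mul (gaussianPDFReal_nonneg _ _ _)]
  congr 1
  simp only [gaussianPDFReal, complexGaussianPDF, Complex.sq_norm, Complex.normSq_apply,
    Complex.measurableEquivRealProd_symm_apply]
  rw [mul_mul_mul_comm, ← Real.exp_add, ← mul_inv, Real.mul_self_sqrt (by positivity)]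
  congr 2
  · push_cast; ring
  · push_cast; ring

instance : IsProbabilityMeasure complexGaussian := by
  unfold complexGaussian
  exact Measure.isProbabilityMeasure_map (by fun_prop)

theorem integrable_complexGaussianPDF : Integrable complexGaussianPDF := by
  refine ⟨continuous_complexGaussianPDF.aestronglyMeasurable, ?_⟩
  rw [hasFiniteIntegral_iff_ofReal (ae_of_all _ complexGaussianPDF_nonneg)]
  have h : complexGaussian Set.univ = 1 := measure_univ
  rw [complexGaussian_eq_withDensity, withDensity_apply _ MeasurableSet.univ,
    Measure.restrict_univ] at h
  rw [h]; exact ENNReal.one_lt_top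

/-- The law of a family of independent `CN(0,1)` variables. -/
def gaussianFamily (ι : Type*) [Fintype ι] : Measure (ι → ℂ) :=
  Measure.pi fun _ => complexGaussian

instance (ι : Type*) [Fintype ι] : IsProbabilityMeasure (gaussianFamily ι) := by
  unfold gaussianFamily; infer_instance

theorem gaussianFamily_eq_withDensity (ι : Type*) [Fintype ι] :
    gaussianFamily ι = volume.withDensity fun x =>
      ENNReal.ofReal ((Real.pi⁻¹) ^ Fintype.card ι * Real.exp (-∑ i, ‖x i‖ ^ 2)) := by
  rw [gaussianFamily, complexGaussian_eq_withDensity,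
    pi_withDensity _ integrable_complexGaussianPDF complexGaussianPDF_nonneg, volume_pi]
  congr 2
  ext x
  congr 1
  simp [complexGaussianPDF, Finset.prod_mul_distrib, ← Real.exp_sum]

/-- Gaussian families are invariant under linear isometries. -/
theorem map_gaussianFamily {ι : Type*} [Fintype ι] (L : (ι → ℂ) →ₗ[ℝ] (ι → ℂ))
    (hL : ∀ x, ∑ i, ‖L x i‖ ^ 2 = ∑ i, ‖x i‖ ^ 2) :
    (gaussianFamily ι).map L = gaussianFamily ι := by
  have hinj : Function.Injective L := by
    rw [injective_iff_map_eq_zero]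
    intro x hx
    have h := hL x
    simp only [hx, Pi.zero_apply, norm_zero, ne_eq, OfNat.ofNat_ne_zero, not_false_eq_true,
      zero_pow, Finset.sum_const_zero] at h
    have h' := (Finset.sum_eq_zero_iff_of_nonneg fun i _ => by positivity).1 h.symm
    ext i
    simpa using h' i (Finset.mem_univ i)
  have hdet : LinearMap.det L ≠ 0 :=
    (LinearMap.isUnit_iff_isUnit_det L).1
      ((LinearMap.isUnit_iff_ker_eq_bot L).2 (LinearMap.ker_eq_bot.2 hinj)) |>.ne_zero
  have hcont : Continuous L := L.continuous_of_finiteDimensional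
  -- The density depends on the norm only, so the image measure is a constant multiple of the
  -- original. Total mass 1 then forces the constant to be 1, and the determinant need not be
  -- computed.
  have hmap : (gaussianFamily ι).map L =
      ENNReal.ofReal |(LinearMap.det L)⁻¹| • gaussianFamily ι := by
    have h1 : (gaussianFamily ι) = volume.withDensity fun x =>
      ENNReal.ofReal ((Real.pi⁻¹) ^ Fintype.card ι * Real.exp (-∑ i, ‖L x i‖ ^ 2)) := by
      simp_rw [hL]; exact gaussianFamily_eq_withDensity ι
    conv_lhs => rw [h1]
    rw [map_withDensity_comp (f := fun x => ENNReal.ofReal ((Real.pi⁻¹) ^ Fintype.card ι *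
      Real.exp (-∑ i, ‖x i‖ ^ 2))) _ hcont.measurable (by fun_prop),
      Measure.map_linearMap_addHaar_eq_smul_addHaar _ hdet, withDensity_smul_measure,
      ← gaussianFamily_eq_withDensity]
  have : IsProbabilityMeasure ((gaussianFamily ι).map L) :=
    Measure.isProbabilityMeasure_map hcont.measurable.aemeasurable
  have h1 : (gaussianFamily ι).map L Set.univ = 1 := measure_univ
  rw [hmap] at h1
  simp only [Measure.smul_apply, measure_univ, smul_eq_mul, mul_one] at h1
  rw [hmap, h1, one_smul]

theorem measurePreserving_gaussianFamily {ι : Type*} [Fintype ι] (L : (ι → ℂ) →ₗ[ℝ] (ι → ℂ))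
    (hL : ∀ x, ∑ i, ‖L x i‖ ^ 2 = ∑ i, ‖x i‖ ^ 2) :
    MeasurePreserving L (gaussianFamily ι) (gaussianFamily ι) :=
  ⟨L.continuous_of_finiteDimensional.measurable, map_gaussianFamily L hL⟩

/-! ### The squared norm and the gamma law -/

/-- Polar coordinates in real dimension 2n+2, followed by s = r². The constant is left unspecified,
since normalisation of the gamma law determines the only product in which it occurs. -/
theorem integral_comp_sum_norm_sq (n : ℕ) : ∃ C : ℝ, ∀ g : ℝ → ℝ,
    ∫ x : Fin (n + 1) → ℂ, g (∑ i, ‖x i‖ ^ 2) = C * ∫ s in Set.Ioi 0, s ^ n * g s := by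
  let e := (PiLp.continuousLinearEquiv 2 ℝ (fun _ : Fin (n + 1) => ℂ)).symm
  let m : Measure (EuclideanSpace ℂ (Fin (n + 1))) := volume.map e
  have hm : m.IsAddHaarMeasure := e.isAddHaarMeasure_map volume
  have hdim : Module.finrank ℝ (EuclideanSpace ℂ (Fin (n + 1))) = 2 * n + 2 := by
    rw [← e.toLinearEquiv.finrank_eq, Module.finrank_pi_fintype]
    simp [Complex.finrank_real_complex]; ring
  refine ⟨(2 * n + 2) * m.real (Metric.ball 0 1) / 2, fun g => ?_⟩
  have h1 : ∫ x : Fin (n + 1) → ℂ, g (∑ i, ‖x i‖ ^ 2) = ∫ v, g (‖v‖ ^ 2) ∂m := by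
    have he : MeasurableEmbedding e := e.toHomeomorph.measurableEmbedding
    simp only [m]
    rw [he.integral_map]
    refine integral_congr_ae (ae_of_all _ fun x => ?_)
    simp only [EuclideanSpace.norm_sq_eq]
    rfl
  have h2 : ∫ s in Set.Ioi 0, s ^ n * g s =
      2 * ∫ r in Set.Ioi (0 : ℝ), r ^ (2 * n + 1) * g (r ^ 2) := by
    rw [← integral_comp_rpow_Ioi (fun s => s ^ n * g s) (two_ne_zero' ℝ), ← integral_const_mul]
    refine setIntegral_congr_fun measurableSet_Ioi fun r hr => ?_
    have e1 : (2 : ℝ) - 1 = 1 := by norm_num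
    simp only [e1, Real.rpow_one, Real.rpow_two, smul_eq_mul, abs_two]
    ring
  have h3 := integral_fun_norm_addHaar m (fun r => g (r ^ 2))
  rw [hdim] at h3
  rw [h1, h3, h2]
  simp only [nsmul_eq_mul, smul_eq_mul,
    show 2 * n + 2 - 1 = 2 * n + 1 from rfl]
  push_cast; ring

/-- The density of the gamma law with shape `n + 1`. -/
def gammaDensity (n : ℕ) (s : ℝ) : ℝ := s ^ n * Real.exp (-s) / n.factorial

theorem continuous_gammaDensity (n : ℕ) : Continuous (gammaDensity n) := by
  unfold gammaDensity; fun_prop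

theorem gammaDensity_nonneg (n : ℕ) {s : ℝ} (hs : 0 ≤ s) : 0 ≤ gammaDensity n s := by
  unfold gammaDensity; positivity

theorem integrableOn_gammaDensity (n : ℕ) : IntegrableOn (gammaDensity n) (Set.Ioi 0) := by
  have h := (Real.GammaIntegral_convergent (s := n + 1) (by positivity)).div_const
    (n.factorial : ℝ)
  refine h.congr (ae_of_all _ fun s => ?_)
  simp [gammaDensity, mul_comm]

theorem integral_gammaDensity (n : ℕ) : ∫ s in Set.Ioi 0, gammaDensity n s = 1 := by
  have h := Real.Gamma_eq_integral (s := n + 1) (by positivity)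
  rw [Real.Gamma_nat_eq_factorial] at h
  simp only [add_sub_cancel_right, Real.rpow_natCast] at h
  simp only [gammaDensity, integral_div, mul_comm _ (Real.exp _)]
  rw [← h]
  exact div_self (by positivity)

/-- The gamma law with shape `n + 1` and unit rate. -/
def gammaLaw (n : ℕ) : Measure ℝ :=
  (volume.restrict (Set.Ioi 0)).withDensity fun s => ENNReal.ofReal (gammaDensity n s)

instance (n : ℕ) : IsProbabilityMeasure (gammaLaw n) := by
  constructor
  rw [gammaLaw, withDensity_apply _ MeasurableSet.univ, Measure.restrict_univ,
    ← ofReal_integral_eq_lintegral_ofReal (integrableOn_gammaDensity n), integral_gammaDensity,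
    ENNReal.ofReal_one]
  exact (ae_restrict_iff' measurableSet_Ioi).2
    (ae_of_all _ fun s hs => gammaDensity_nonneg n (le_of_lt hs))

/-- The squared norm of a complex Gaussian vector follows a gamma law. -/
theorem map_sum_norm_sq_gaussianFamily (n : ℕ) :
    (gaussianFamily (Fin (n + 1))).map (fun x => ∑ i, ‖x i‖ ^ 2) = gammaLaw n := by
  obtain ⟨C, hC⟩ := integral_comp_sum_norm_sq n
  have hmeas : Measurable fun x : Fin (n + 1) → ℂ => ∑ i, ‖x i‖ ^ 2 := by fun_prop
  set K : ℝ := Real.pi⁻¹ ^ Fintype.card (Fin (n + 1)) with hK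
  have hK0 : 0 ≤ K := by positivity
  have key : ∀ A : Set ℝ, MeasurableSet A →
      (gaussianFamily (Fin (n + 1))).real ((fun x => ∑ i, ‖x i‖ ^ 2) ⁻¹' A) =
        (C * K * n.factorial) * (gammaLaw n).real A := by
    intro A hA
    have h1 : (gaussianFamily (Fin (n + 1))).real ((fun x => ∑ i, ‖x i‖ ^ 2) ⁻¹' A) =
        ∫ x : Fin (n + 1) → ℂ, A.indicator (fun s => K * Real.exp (-s)) (∑ i, ‖x i‖ ^ 2) := by
      rw [measureReal_def, gaussianFamily_eq_withDensity, withDensity_apply _ (hmeas hA),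
        ← integral_toReal, ← integral_indicator (hmeas hA)]
      · refine integral_congr_ae (ae_of_all _ fun x => ?_)
        by_cases hx : ∑ i, ‖x i‖ ^ 2 ∈ A
        · simp only [Set.indicator, Set.mem_preimage, hx, if_true]
          rw [ENNReal.toReal_ofReal (by positivity)]
        · simp [Set.indicator, hx]
      · exact Measurable.aemeasurable (by fun_prop)
      · exact ae_of_all _ fun x => ENNReal.ofReal_lt_top
    have h2 : (gammaLaw n).real A =
        ∫ s in Set.Ioi 0, A.indicator (gammaDensity n) s := by
      rw [measureReal_def, gammaLaw, withDensity_apply _ hA, ← integral_toReal,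
        ← integral_indicator hA]
      · refine setIntegral_congr_fun measurableSet_Ioi fun s hs => ?_
        simp only [Set.indicator]
        rw [ENNReal.toReal_ofReal (gammaDensity_nonneg n (le_of_lt hs))]
      · exact ((continuous_gammaDensity n).measurable.ennreal_ofReal).aemeasurable
      · exact ae_of_all _ fun x => ENNReal.ofReal_lt_top
    rw [h1, hC, h2, ← integral_const_mul, ← integral_const_mul]
    refine integral_congr_ae (ae_of_all _ fun s => ?_)
    by_cases hs : s ∈ A
    · simp only [Set.indicator, hs, if_true, gammaDensity]
      field_simp
    · simp [Set.indicator, hs]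
  have h1 : C * K * n.factorial = 1 := by
    have := key Set.univ MeasurableSet.univ
    simpa using this.symm
  ext A hA
  rw [Measure.map_apply hmeas hA]
  have := key A hA
  rw [h1, one_mul] at this
  exact (measureReal_eq_measureReal_iff).1 this

/-! ### Symmetries of the channel law and the recursion -/

theorem sum_norm_sq_unitary_mulVec {α : Type*} [Fintype α] [DecidableEq α] {U : Matrix α α ℂ}
    (hU : U ∈ Matrix.unitaryGroup α ℂ) (v : α → ℂ) :
    ∑ i, ‖(U *ᵥ v) i‖ ^ 2 = ∑ i, ‖v i‖ ^ 2 := by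
  have h1 : Uᴴ * U = 1 := Matrix.mem_unitaryGroup_iff'.1 hU
  have h : (U *ᵥ v) ⬝ᵥ star (U *ᵥ v) = v ⬝ᵥ star v := by
    rw [dotProduct_comm, Matrix.star_mulVec, Matrix.dotProduct_mulVec, Matrix.vecMul_vecMul, h1,
      Matrix.vecMul_one, dotProduct_comm]
  rw [dotProduct_star_self_eq_sum_norm, dotProduct_star_self_eq_sum_norm] at h
  exact_mod_cast h

/-- A family indexed by pairs, seen as a matrix. -/
def pairMatrix {α β : Type*} (f : α × β → ℂ) : Matrix α β ℂ := Matrix.of fun i j => f (i, j)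

theorem continuous_pairMatrix {α β : Type*} :
    Continuous (pairMatrix : (α × β → ℂ) → Matrix α β ℂ) := by
  unfold pairMatrix
  exact continuous_matrix fun i j => continuous_apply (i, j)

/-- Left multiplication by a matrix, acting on families indexed by pairs. -/
def pairMulLeft {α β : Type*} [Fintype α] (U : Matrix α α ℂ) : (α × β → ℂ) →ₗ[ℝ] (α × β → ℂ) where
  toFun f := fun p => (U *ᵥ fun i => f (i, p.2)) p.1
  map_add' f g := by
    ext p
    exact congrFun (Matrix.mulVec_add U (fun i => f (i, p.2)) fun i => g (i, p.2)) p.1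
  map_smul' r f := by
    ext p
    exact congrFun (Matrix.mulVec_smul U r fun i => f (i, p.2)) p.1

theorem pairMatrix_pairMulLeft {α β : Type*} [Fintype α] (U : Matrix α α ℂ) (f : α × β → ℂ) :
    pairMatrix (pairMulLeft U f) = U * pairMatrix f := rfl

theorem measurePreserving_pairMulLeft {α β : Type*} [Fintype α] [DecidableEq α] [Fintype β]
    {U : Matrix α α ℂ} (hU : U ∈ Matrix.unitaryGroup α ℂ) :
    MeasurePreserving (pairMulLeft (β := β) U) (gaussianFamily (α × β))
      (gaussianFamily (α × β)) := by
  have hL : ∀ x : α × β → ℂ, ∑ p, ‖pairMulLeft U x p‖ ^ 2 = ∑ p, ‖x p‖ ^ 2 := fun x => by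
    rw [Fintype.sum_prod_type_right, Fintype.sum_prod_type_right]
    exact Finset.sum_congr rfl fun j _ => sum_norm_sq_unitary_mulVec hU fun i => x (i, j)
  exact measurePreserving_gaussianFamily (pairMulLeft U) hL

/-- The index bijection that separates the first row of a matrix from the others. -/
def rowSplitEquiv (N M : ℕ) : (Fin M ⊕ Fin M × Fin N) ≃ Fin (N + 1) × Fin M where
  toFun := Sum.elim (fun i => (0, i)) fun p => (p.2.succ, p.1)
  invFun p := Fin.cases (motive := fun _ => Fin M ⊕ Fin M × Fin N)
    (Sum.inl p.2) (fun j => Sum.inr (p.2, j)) p.1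
  left_inv := by rintro (i | ⟨i, j⟩) <;> rfl
  right_inv := by
    rintro ⟨k, i⟩
    refine Fin.cases ?_ (fun j => ?_) k <;> rfl

theorem measurePreserving_comp_equiv {ι κ : Type*} [Fintype ι] [Fintype κ] (σ : κ ≃ ι) :
    MeasurePreserving (fun f : ι → ℂ => fun k => f (σ k)) (gaussianFamily ι)
      (gaussianFamily κ) :=
  (measurePreserving_piCongrLeft (fun _ : ι => complexGaussian) σ).symm

theorem measurePreserving_star {ι : Type*} [Fintype ι] :
    MeasurePreserving (fun f : ι → ℂ => fun i => star (f i)) (gaussianFamily ι)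
      (gaussianFamily ι) :=
  measurePreserving_gaussianFamily
    (LinearMap.pi fun i => Complex.conjAe.toLinearMap ∘ₗ LinearMap.proj i) fun x => by simp

/-- Supplies the transposed problem of `gramForm_single`: the conjugated first row becomes the new
desired channel, and the other rows its interferers, independent of it. -/
theorem measurePreserving_rowSplit (N M : ℕ) :
    MeasurePreserving (fun f : Fin (N + 1) × Fin M → ℂ =>
        ((fun i => star (f (0, i)), fun p => star (f (p.2.succ, p.1))) :
          (Fin M → ℂ) × (Fin M × Fin N → ℂ)))
      (gaussianFamily (Fin (N + 1) × Fin M))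
      ((gaussianFamily (Fin M)).prod (gaussianFamily (Fin M × Fin N))) :=
  ((measurePreserving_sumPiEquivProdPi
    (fun _ : Fin M ⊕ Fin M × Fin N => complexGaussian)).comp
    (measurePreserving_comp_equiv (rowSplitEquiv N M))).comp measurePreserving_star

/-- The joint law of the desired channel and of the interferers' channels. -/
def channelLaw (N M : ℕ) : Measure ((Fin N → ℂ) × (Fin N × Fin M → ℂ)) :=
  (gaussianFamily (Fin N)).prod (gaussianFamily (Fin N × Fin M))

instance (N M : ℕ) : IsProbabilityMeasure (channelLaw N M) := by
  unfold channelLaw; infer_instance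

/-- The quadratic form `h† (K K† + c I)⁻¹ h` as a function of the channels. -/
def channelForm (c : ℝ) {N M : ℕ} (p : (Fin N → ℂ) × (Fin N × Fin M → ℂ)) : ℝ :=
  gramForm c p.1 (pairMatrix p.2)

theorem measurable_channelForm {c : ℝ} (hc : 0 < c) (N M : ℕ) :
    Measurable (channelForm c : (Fin N → ℂ) × (Fin N × Fin M → ℂ) → ℝ) :=
  ((continuous_gramForm hc).comp
    (continuous_fst.prodMk (continuous_pairMatrix.comp continuous_snd))).measurable

theorem channelForm_nonneg {c : ℝ} (hc : 0 < c) {N M : ℕ}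
    (p : (Fin N → ℂ) × (Fin N × Fin M → ℂ)) : 0 ≤ channelForm c p :=
  gramForm_nonneg hc _ _

theorem measurable_gramForm_pairMatrix {c : ℝ} (hc : 0 < c) {N M : ℕ} (h : Fin N → ℂ) :
    Measurable fun f : Fin N × Fin M → ℂ => gramForm c h (pairMatrix f) :=
  (measurable_channelForm hc N M).comp (measurable_const.prodMk measurable_id)

theorem measurableSet_mul_channelForm_lt {c : ℝ} (hc : 0 < c) (N M : ℕ) (y s : ℝ) :
    MeasurableSet {p : (Fin N → ℂ) × (Fin N × Fin M → ℂ) |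
      y * (c * (1 + channelForm c p)) < s} :=
  measurableSet_lt ((((measurable_channelForm hc N M).const_add 1).const_mul c).const_mul y)
    measurable_const

theorem gaussianFamily_lt_gramForm_unitary {c : ℝ} (hc : 0 < c) {N M : ℕ} (h : Fin N → ℂ)
    (y : ℝ) {U : Matrix (Fin N) (Fin N) ℂ} (hU : U ∈ Matrix.unitaryGroup (Fin N) ℂ) :
    gaussianFamily (Fin N × Fin M) {f | y < gramForm c h (pairMatrix f)} =
      gaussianFamily (Fin N × Fin M) {f | y < gramForm c (U *ᵥ h) (pairMatrix f)} := by
  rw [← (measurePreserving_pairMulLeft (β := Fin M) hU).measure_preimage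
    (measurableSet_lt measurable_const
      (measurable_gramForm_pairMatrix hc (U *ᵥ h))).nullMeasurableSet]
  congr 1
  ext f
  simp only [Set.mem_ofPred_eq, Set.mem_preimage]
  rw [pairMatrix_pairMulLeft, gramForm_unitary_mul hc hU]

theorem gaussianFamily_lt_gramForm {c : ℝ} (hc : 0 < c) {N M : ℕ} (h : Fin (N + 1) → ℂ) (y : ℝ) :
    gaussianFamily (Fin (N + 1) × Fin M) {f | y < gramForm c h (pairMatrix f)} =
      channelLaw M N {p | y * (c * (1 + channelForm c p)) < ∑ i, ‖h i‖ ^ 2} := by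
  have hex := exists_unitary_mulVec_eq_single h
  rw [gaussianFamily_lt_gramForm_unitary hc h y hex.choose_spec.1, hex.choose_spec.2, channelLaw,
    ← (measurePreserving_rowSplit N M).measure_preimage
      (measurableSet_mul_channelForm_lt hc M N y _).nullMeasurableSet]
  congr 1
  ext f
  have hnn : 0 ≤ ∑ i, ‖h i‖ ^ 2 := by positivity
  simp only [Set.mem_ofPred_eq, Set.mem_preimage]
  rw [gramForm_smul, gramForm_single hc, Complex.norm_real, Real.norm_eq_abs, sq_abs,
    Real.sq_sqrt hnn, ← div_eq_mul_inv, lt_div_iff₀]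
  · rfl
  · have := gramForm_nonneg hc (fun i => star (pairMatrix f 0 i))
      (Matrix.of fun i (j : Fin N) => star (pairMatrix f j.succ i))
    positivity

/-- The recursion for the law of the quadratic form: the quadratic form with `N + 1` receive
antennas and `M` interferers has the law of `G / (c (1 + Q'))`, where `G` follows a gamma law and
`Q'` is an independent quadratic form with `M` antennas and `N` interferers. -/
theorem channelLaw_lt_channelForm {c : ℝ} (hc : 0 < c) (N M : ℕ) (y : ℝ) :
    channelLaw (N + 1) M {p | y < channelForm c p} =
      ∫⁻ s, channelLaw M N {p | y * (c * (1 + channelForm c p)) < s} ∂gammaLaw N := by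
  have hmeas : MeasurableSet {p : (Fin (N + 1) → ℂ) × (Fin (N + 1) × Fin M → ℂ) |
      y < channelForm c p} :=
    measurableSet_lt measurable_const (measurable_channelForm hc _ _)
  have hmono : Monotone fun s => channelLaw M N {p | y * (c * (1 + channelForm c p)) < s} :=
    fun s t hst => measure_mono fun p hp => lt_of_lt_of_le hp hst
  rw [← map_sum_norm_sq_gaussianFamily, lintegral_map hmono.measurable (by fun_prop), channelLaw,
    Measure.prod_apply hmeas]
  exact lintegral_congr fun h => gaussianFamily_lt_gramForm hc h y

/-! ### The survival function and its binomial tails -/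

/-- The probability that the `(r + 1)`-st success of a sequence of Bernoulli trials with odds `y`
comes within the first `M` trials. -/
def negBinomialTail (M r : ℕ) (y : ℝ) : ℝ :=
  y ^ (r + 1) * ∑ j ∈ Finset.range M, (j.choose r : ℝ) * ((1 + y) ^ (j + 1))⁻¹

/-- The (r+1)-st success falls outside the first M trials exactly when these contain at most r
successes. The induction on M is Pascal's rule. -/
theorem one_sub_negBinomialTail (M r : ℕ) {y : ℝ} (hy : 0 ≤ y) :
    1 - negBinomialTail M r y =
      ((1 + y) ^ M)⁻¹ * ∑ i ∈ Finset.range (r + 1), (M.choose i : ℝ) * y ^ i := by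
  have h1 : 1 + y ≠ 0 := by positivity
  induction M with
  | zero => simp [negBinomialTail, Finset.sum_range_succ']
  | succ M ih =>
    have hpascal : ∑ i ∈ Finset.range (r + 1), ((M + 1).choose i : ℝ) * y ^ i =
        (1 + y) * ∑ i ∈ Finset.range (r + 1), (M.choose i : ℝ) * y ^ i -
          M.choose r * y ^ (r + 1) := by
      have h2 := Finset.sum_range_succ (fun i => (M.choose i : ℝ) * y ^ (i + 1)) r
      rw [Finset.sum_range_succ', add_mul, one_mul, Finset.mul_sum]
      conv_rhs => enter [1, 1]; rw [Finset.sum_range_succ']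
      simp only [Nat.choose_succ_succ, Nat.cast_add, add_mul, Finset.sum_add_distrib]
      have h3 : ∑ i ∈ Finset.range (r + 1), y * ((M.choose i : ℝ) * y ^ i) =
          ∑ i ∈ Finset.range (r + 1), (M.choose i : ℝ) * y ^ (i + 1) :=
        Finset.sum_congr rfl fun i _ => by ring
      rw [h3, h2]
      simp
      ring
    have h4 : negBinomialTail (M + 1) r y =
        negBinomialTail M r y + y ^ (r + 1) * (M.choose r * ((1 + y) ^ (M + 1))⁻¹) := by
      rw [negBinomialTail, negBinomialTail, Finset.sum_range_succ, mul_add]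
    rw [h4, ← sub_sub, ih, hpascal]
    field_simp
    ring

/-- The survival function of the quadratic form `h† (K K† + c I)⁻¹ h` in `N` dimensions, with `M`
columns in `K`. -/
def survival (c : ℝ) (N M : ℕ) (y : ℝ) : ℝ :=
  Real.exp (-(c * y)) * ((1 + y) ^ M)⁻¹ * ∑ j ∈ Finset.range N,
    ∑ p ∈ Finset.HasAntidiagonal.antidiagonal j, (c * y) ^ p.1 / p.1.factorial * (M.choose p.2 * y ^ p.2)

/-- Conditioning on the Poisson count k: the binomial count must then be at most N-1-k. -/
theorem survival_eq (c : ℝ) (N M : ℕ) {y : ℝ} (hy : 0 ≤ y) :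
    survival c N M y = Real.exp (-(c * y)) * ∑ k ∈ Finset.range N,
      (c * y) ^ k / k.factorial * (1 - negBinomialTail M (N - 1 - k) y) := by
  have h := Finset.sum_range_diag_flip N
    (fun k i => (c * y) ^ k / k.factorial * ((M.choose i : ℝ) * y ^ i))
  rw [survival]
  simp only [Finset.Nat.sum_antidiagonal_eq_sum_range_succ
    (fun k i => (c * y) ^ k / k.factorial * ((M.choose i : ℝ) * y ^ i)), Nat.succ_eq_add_one]
  rw [h, mul_assoc, Finset.mul_sum]
  congr 1
  refine Finset.sum_congr rfl fun k hk => ?_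
  have hk' : N - 1 - k + 1 = N - k := by have := Finset.mem_range.1 hk; omega
  rw [one_sub_negBinomialTail _ _ hy, hk', ← Finset.mul_sum]
  ring

/-! ### Gamma integrals -/

theorem integral_Ioi_gammaDensity (n : ℕ) {x : ℝ} (hx : 0 ≤ x) :
    ∫ s in Set.Ioi x, gammaDensity n s =
      Real.exp (-x) * ∑ k ∈ Finset.range (n + 1), x ^ k / k.factorial := by
  have hderiv : ∀ s : ℝ, HasDerivAt
      (fun s => -(Real.exp (-s) * ∑ k ∈ Finset.range (n + 1), s ^ k / k.factorial))
      (gammaDensity n s) s := by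
    intro s
    have he : HasDerivAt (fun s => Real.exp (-s)) (-Real.exp (-s)) s := by
      simpa using (hasDerivAt_neg s).exp
    induction n with
    | zero =>
      simpa [gammaDensity] using he.fun_neg
    | succ n ih =>
      have h1 : HasDerivAt (fun s : ℝ => s ^ (n + 1) / (n + 1).factorial)
          ((n + 1 : ℕ) * s ^ n / (n + 1).factorial) s := by
        simpa using (hasDerivAt_pow (n + 1) s).div_const ((n + 1).factorial : ℝ)
      have h2 := ih.sub (he.mul h1)
      refine (h2.congr_deriv ?_).congr_of_eventuallyEq (Filter.Eventually.of_forall fun t => ?_)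
      · simp only [gammaDensity, Nat.factorial_succ]
        push_cast
        field_simp
        ring
      · simp only [Pi.sub_apply, Pi.mul_apply]
        rw [Finset.sum_range_succ _ (n + 1)]
        ring
  have htend : Filter.Tendsto
      (fun s => -(Real.exp (-s) * ∑ k ∈ Finset.range (n + 1), s ^ k / k.factorial))
      Filter.atTop (nhds 0) := by
    rw [← neg_zero]
    refine Filter.Tendsto.neg ?_
    simp only [Finset.mul_sum]
    rw [← Finset.sum_const_zero (s := Finset.range (n + 1))]
    refine tendsto_finsetSum _ fun k _ => ?_
    have := (Real.tendsto_pow_mul_exp_neg_atTop_nhds_zero k).div_const (k.factorial : ℝ)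
    rw [zero_div] at this
    exact this.congr fun s => by ring
  rw [integral_Ioi_of_hasDerivAt_of_tendsto' (fun s _ => hderiv s)
    ((integrableOn_gammaDensity n).mono_set (Set.Ioi_subset_Ioi hx)) htend]
  ring

theorem integral_pow_mul_exp_neg_mul (j : ℕ) {r : ℝ} (hr : 0 < r) :
    ∫ q in Set.Ioi (0 : ℝ), q ^ j * Real.exp (-(r * q)) = j.factorial / r ^ (j + 1) := by
  have h := Real.integral_rpow_mul_exp_neg_mul_Ioi (a := j + 1) (by positivity) hr
  simp only [add_sub_cancel_right, Real.rpow_natCast] at h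
  rw [h, Real.Gamma_nat_eq_factorial, ← Nat.cast_succ, Real.rpow_natCast, one_div, inv_pow,
    div_eq_inv_mul]

theorem integrableOn_pow_mul_exp_neg_mul (j : ℕ) {r : ℝ} (hr : 0 < r) :
    IntegrableOn (fun q : ℝ => q ^ j * Real.exp (-(r * q))) (Set.Ioi 0) := by
  by_contra h
  have h1 := integral_pow_mul_exp_neg_mul j hr
  -- A non-integrable function has integral 0 by convention, whereas the value found is positive.
  rw [integral_undef h] at h1
  have : (0 : ℝ) < j.factorial / r ^ (j + 1) := by positivity
  exact this.ne h1

/-! ### The hypergeometric function in closed form -/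

/-- This is the equality of the coefficients of xⁿ in `isGaussHypergeometric_closedForm`, cleared of
denominators; the power series of (1-x)^-(j+1) has coefficients C(n+j, j). -/
theorem sum_choose_mul_choose (M r n : ℕ) :
    (r + 1 + n) * ∑ j ∈ Finset.range M, j.choose r * (n + j).choose j =
      (r + 1) * M.choose (r + 1) * (M + n).choose M := by
  induction M with
  | zero => simp
  | succ M ih =>
    rw [Finset.sum_range_succ, mul_add, ih]
    obtain h | h := lt_or_ge M r
    · simp [Nat.choose_eq_zero_of_lt h, Nat.choose_eq_zero_of_lt (show M < r + 1 by omega),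
        Nat.choose_eq_zero_of_lt (show M + 1 < r + 1 by omega)]
    · obtain ⟨d, rfl⟩ := Nat.exists_eq_add_of_le h
      have e1 := Nat.add_one_mul_choose_eq (r + d) r
      have e2 := Nat.choose_succ_right_eq (r + d) r
      have e3 := Nat.add_one_mul_choose_eq (r + d + n) (r + d)
      have e4 : r + d + 1 + n = (r + d + n) + 1 := by omega
      have e5 : n + (r + d) = r + d + n := by omega
      rw [show r + d - r = d by omega] at e2
      rw [e4, e5]
      calc (r + 1) * (r + d).choose (r + 1) * (r + d + n).choose (r + d) +
            (r + 1 + n) * ((r + d).choose r * (r + d + n).choose (r + d))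
          = (((r + d).choose (r + 1) * (r + 1)) + (r + 1 + n) * (r + d).choose r) *
              (r + d + n).choose (r + d) := by ring
        _ = (r + d).choose r * ((r + d + n + 1) * (r + d + n).choose (r + d)) := by
            rw [e2]; ring
        _ = ((r + d + 1) * (r + d).choose r) * (r + d + n + 1).choose (r + d + 1) := by
            rw [e3]; ring
        _ = _ := by rw [e1]; ring

/-- A closed form of the hypergeometric function `₂F₁(M + 1, r + 1; r + 2; x)` for `r < M`. -/
theorem isGaussHypergeometric_closedForm {M r : ℕ} (hr : r < M) :
    IsGaussHypergeometric (M + 1) (r + 1) (r + 2) fun x =>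
      (∑ j ∈ Finset.range M, (j.choose r : ℝ) * ((1 - x) ^ (j + 1))⁻¹) / M.choose (r + 1) := by
  constructor
  · intro x hx
    have hx1 : (1 - x) ≠ 0 := by have : x < 1 := hx; linarith
    refine AnalyticAt.div ?_ analyticAt_const
      (by exact_mod_cast (Nat.choose_pos (show r + 1 ≤ M from hr)).ne')
    refine Finset.analyticAt_fun_sum _ fun j _ => ?_
    refine analyticAt_const.mul (AnalyticAt.inv ?_ (pow_ne_zero _ hx1))
    exact (analyticAt_const.sub analyticAt_id).pow _
  · intro x hx
    have hsum := hasSum_sum (s := Finset.range M) fun j _ =>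
      (hasSum_choose_mul_geometric_of_norm_lt_one j (r := x) (by simpa using hx)).mul_left
        (j.choose r : ℝ)
    have hsum' := (hsum.div_const (M.choose (r + 1) : ℝ)).tsum_eq
    simp only [one_div] at hsum'
    beta_reduce
    rw [← hsum', ordinaryHypergeometric_eq_tsum]
    refine tsum_congr fun n => ?_
    have hM : (M.choose (r + 1) : ℝ) ≠ 0 :=
      by exact_mod_cast (Nat.choose_pos (show r + 1 ≤ M from hr)).ne'
    have e1 : ∀ a : ℕ, Polynomial.eval ((a : ℝ) + 1) (ascPochhammer ℝ n) =
        (a + n).factorial / a.factorial := by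
      intro a
      have h1 : ((a : ℝ) + 1) = ((a + 1 : ℕ) : ℝ) := by push_cast; rfl
      rw [h1, ← Nat.cast_ascFactorial, eq_div_iff (by positivity), mul_comm]
      exact_mod_cast Nat.factorial_mul_ascFactorial a n
    have e2 : ((r : ℝ) + 2) = ((r + 1 : ℕ) : ℝ) + 1 := by push_cast; ring
    have hs : ((r : ℝ) + 1 + n) * ∑ j ∈ Finset.range M, (j.choose r : ℝ) * ((n + j).choose j) =
        (r + 1) * M.choose (r + 1) * (M + n).choose M := by
      exact_mod_cast sum_choose_mul_choose M r n
    have hs' : ∑ j ∈ Finset.range M, (j.choose r : ℝ) * ((n + j).choose j) =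
        (r + 1) * M.choose (r + 1) * (M + n).choose M / (r + 1 + n) := by
      rw [← hs]; field_simp
    have hs2 : ∑ j ∈ Finset.range M, (j.choose r : ℝ) * (((n + j).choose j) * x ^ n) =
        (∑ j ∈ Finset.range M, (j.choose r : ℝ) * ((n + j).choose j)) * x ^ n := by
      rw [Finset.sum_mul]; exact Finset.sum_congr rfl fun j _ => by ring
    rw [hs2, hs', e2, e1, e1, e1, Nat.cast_choose ℝ (Nat.le_add_right M n),
      Nat.add_sub_cancel_left, show r + 1 + n = (r + n) + 1 by ring, Nat.factorial_succ (r + n),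
      Nat.factorial_succ r, smul_eq_mul]
    push_cast
    have : (r : ℝ) + n + 1 ≠ 0 := by positivity
    have : (r : ℝ) + 1 + n ≠ 0 := by positivity
    field_simp
    ring

theorem gaussHypergeometric_mul_eq_negBinomialTail {M r : ℕ} (hr : r < M) {y : ℝ} (hy : 0 ≤ y) :
    M.choose (r + 1) * y ^ (r + 1) * gaussHypergeometric (M + 1) (r + 1) (r + 2) (-y) =
      negBinomialTail M r y := by
  have hM : (M.choose (r + 1) : ℝ) ≠ 0 :=
    by exact_mod_cast (Nat.choose_pos (show r + 1 ≤ M from hr)).ne'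
  rw [(isGaussHypergeometric_closedForm hr).eq_gaussHypergeometric (by linarith),
    negBinomialTail]
  simp only [sub_neg_eq_add]
  field_simp

/-! ### The closed form satisfies the recursion -/

theorem choose_mul_pow_div_factorial {c y : ℝ} (hc : c ≠ 0) (hy : 1 + y ≠ 0) {N j i : ℕ}
    (hN : i ≤ N) (hj : i ≤ j) :
    (c * y) ^ (N - i) / (N - i).factorial * (y ^ (i + 1) * (j.choose i * ((1 + y) ^ (j + 1))⁻¹)) =
      c * y * ((c * y) ^ N / N.factorial * (c ^ (j - i) / (j - i).factorial * N.choose i) *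
        (j.factorial / (c * y + c) ^ (j + 1))) := by
  obtain ⟨a, rfl⟩ := Nat.exists_eq_add_of_le hN
  obtain ⟨b, rfl⟩ := Nat.exists_eq_add_of_le hj
  rw [Nat.cast_choose ℝ hN, Nat.cast_choose ℝ hj, Nat.add_sub_cancel_left, Nat.add_sub_cancel_left]
  have h1 : c * y + c = c * (1 + y) := by ring
  rw [h1, mul_pow c (1 + y)]
  field_simp
  ring

theorem sum_antidiagonal_eq_sum_choose {c y : ℝ} (hc : c ≠ 0) (hy : 1 + y ≠ 0) (N j : ℕ) :
    c * y * ∑ p ∈ Finset.HasAntidiagonal.antidiagonal j,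
        (c * y) ^ N / N.factorial * (c ^ p.1 / p.1.factorial * N.choose p.2) *
          (j.factorial / (c * y + c) ^ (j + 1)) =
      ∑ i ∈ Finset.range (N + 1), (c * y) ^ (N - i) / (N - i).factorial *
        (y ^ (i + 1) * (j.choose i * ((1 + y) ^ (j + 1))⁻¹)) := by
  rw [← Finset.Nat.sum_antidiagonal_swap]
  simp only [Prod.fst_swap, Prod.snd_swap]
  rw [Finset.Nat.sum_antidiagonal_eq_sum_range_succ (fun i k =>
    (c * y) ^ N / N.factorial * (c ^ k / k.factorial * N.choose i) *
          (j.factorial / (c * y + c) ^ (j + 1))), Finset.mul_sum, Nat.succ_eq_add_one]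
  -- Both sums live on i ≤ min(N, j): beyond it C(N, i) vanishes on the left and C(j, i) on the
  -- right.
  have e1 : Finset.range (min N j + 1) ⊆ Finset.range (j + 1) := by
    intro i; simp only [Finset.mem_range]; omega
  have e2 : Finset.range (min N j + 1) ⊆ Finset.range (N + 1) := by
    intro i; simp only [Finset.mem_range]; omega
  rw [← Finset.sum_subset e1, ← Finset.sum_subset e2]
  · refine Finset.sum_congr rfl fun i hi => ?_
    have hi' := Finset.mem_range.1 hi
    rw [choose_mul_pow_div_factorial hc hy (by omega) (by omega)]
  · intro i h1 h2
    simp only [Finset.mem_range] at h1 h2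
    rw [Nat.choose_eq_zero_of_lt (show j < i by omega)]
    simp
  · intro i h1 h2
    simp only [Finset.mem_range] at h1 h2
    rw [Nat.choose_eq_zero_of_lt (show N < i by omega)]
    simp

theorem integral_gammaDensity_mul_survival {c y : ℝ} (hc : 0 < c) (hy : 0 < y) (N M : ℕ) :
    ∫ s in Set.Ioi (c * y), gammaDensity N s * survival c M N (s / (c * y) - 1) =
      Real.exp (-(c * y)) * ∑ k ∈ Finset.range (N + 1),
        (c * y) ^ k / k.factorial * negBinomialTail M (N - k) y := by
  set x := c * y with hxdef
  have hx : 0 < x := by positivity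
  have hxc : 0 < x + c := by positivity
  have h1 : ∫ s in Set.Ioi x, gammaDensity N s * survival c M N (s / x - 1) =
      x * ∫ q in Set.Ioi (0 : ℝ), gammaDensity N (x * (q + 1)) * survival c M N q := by
    -- Substitution s = x(q+1), done as a scaling and then a shift.
    have e1 := integral_comp_mul_left_Ioi
      (fun s => gammaDensity N s * survival c M N (s / x - 1)) 1 hx
    have e2 := (measurePreserving_add_right volume (1 : ℝ)).setIntegral_preimage_emb
      (measurableEmbedding_addRight 1)
      (fun u => gammaDensity N (x * u) * survival c M N (x * u / x - 1)) (Set.Ioi 1)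
    rw [Set.preimage_add_const_Ioi, sub_self, e1, mul_one] at e2
    have e3 : ∀ q : ℝ, x * (q + 1) / x - 1 = q := fun q => by field_simp; ring
    simp only [e3] at e2
    rw [e2, smul_eq_mul, mul_inv_cancel_left₀ hx.ne']
  have h2 : ∀ q ∈ Set.Ioi (0 : ℝ), gammaDensity N (x * (q + 1)) * survival c M N q =
      ∑ j ∈ Finset.range M, ∑ p ∈ Finset.HasAntidiagonal.antidiagonal j,
        (Real.exp (-x) * (x ^ N / N.factorial * (c ^ p.1 / p.1.factorial * N.choose p.2))) *
          (q ^ j * Real.exp (-((x + c) * q))) := by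
    intro q hq
    have hq0 : (0 : ℝ) < q := hq
    have hexp : Real.exp (-(x * (q + 1))) * Real.exp (-(c * q)) =
        Real.exp (-x) * Real.exp (-((x + c) * q)) := by
      rw [← Real.exp_add, ← Real.exp_add]; congr 1; ring
    -- The power (1+q)^N of the gamma density cancels the denominator of `survival c M N`, leaving
    -- only monomials times exponentials.
    have hcancel : (1 + q) ^ N * ((1 + q) ^ N)⁻¹ = 1 := mul_inv_cancel₀ (by positivity)
    rw [survival, gammaDensity]
    calc _ = ((1 + q) ^ N * ((1 + q) ^ N)⁻¹) * (x ^ N / N.factorial) *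
          (Real.exp (-(x * (q + 1))) * Real.exp (-(c * q))) *
          ∑ j ∈ Finset.range M, ∑ p ∈ Finset.HasAntidiagonal.antidiagonal j,
            (c * q) ^ p.1 / p.1.factorial * (N.choose p.2 * q ^ p.2) := by
            rw [add_comm q 1, mul_pow]; ring
      _ = _ := by
        rw [hcancel, hexp, Finset.mul_sum]
        refine Finset.sum_congr rfl fun j _ => ?_
        rw [Finset.mul_sum]
        refine Finset.sum_congr rfl fun p hp => ?_
        rw [← Finset.HasAntidiagonal.mem_antidiagonal.1 hp, pow_add, mul_pow]
        ring
  have hint := fun j => integrableOn_pow_mul_exp_neg_mul j hxc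
  rw [h1, setIntegral_congr_fun measurableSet_Ioi h2, integral_finsetSum]
  · have h3 : ∀ j ∈ Finset.range M, (∫ q in Set.Ioi (0 : ℝ),
        ∑ p ∈ Finset.HasAntidiagonal.antidiagonal j,
        (Real.exp (-x) * (x ^ N / N.factorial * (c ^ p.1 / p.1.factorial * N.choose p.2))) *
          (q ^ j * Real.exp (-((x + c) * q)))) =
        Real.exp (-x) * ∑ p ∈ Finset.HasAntidiagonal.antidiagonal j,
        x ^ N / N.factorial * (c ^ p.1 / p.1.factorial * N.choose p.2) *
          (j.factorial / (x + c) ^ (j + 1)) := by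
      intro j _
      rw [integral_finsetSum _ fun p _ => (hint j).const_mul _, Finset.mul_sum]
      refine Finset.sum_congr rfl fun p _ => ?_
      rw [integral_const_mul, integral_pow_mul_exp_neg_mul j hxc]
      ring
    rw [Finset.sum_congr rfl h3, ← Finset.mul_sum, mul_left_comm, Finset.mul_sum]
    simp only [hxdef]
    simp only [sum_antidiagonal_eq_sum_choose hc.ne' (by positivity : 1 + y ≠ 0)]
    rw [Finset.sum_comm, ← Finset.sum_range_reflect]
    congr 1
    refine Finset.sum_congr rfl fun k hk => ?_
    have hk' := Finset.mem_range.1 hk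
    have e1 : N + 1 - 1 - k = N - k := by omega
    have e2 : N - (N - k) = k := by omega
    rw [e1, e2, negBinomialTail, Finset.mul_sum, Finset.mul_sum]
  · intro j _
    exact integrable_finsetSum _ fun p _ => (hint j).const_mul _

theorem survival_succ_eq {c y : ℝ} (hc : 0 < c) (hy : 0 < y) (N M : ℕ) :
    survival c (N + 1) M y = (∫ s in Set.Ioi (c * y), gammaDensity N s) -
      ∫ s in Set.Ioi (c * y), gammaDensity N s * survival c M N (s / (c * y) - 1) := by
  rw [integral_gammaDensity_mul_survival hc hy, integral_Ioi_gammaDensity N (by positivity),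
    survival_eq _ _ _ hy.le, ← mul_sub, ← Finset.sum_sub_distrib]
  congr 1
  refine Finset.sum_congr rfl fun k _ => ?_
  rw [Nat.add_sub_cancel]
  ring

/-! ### Induction on the number of antennas plus interferers -/

/-- By Fubini the two sides differ by the μ-mass of single points, which is zero. The non-strict
event is the one whose complement the induction hypothesis describes. -/
theorem lintegral_measure_lt_eq_le {α : Type*} [MeasurableSpace α] (μ : Measure ℝ) [SFinite μ]
    [NullSingletonClass μ] (ν : Measure α) [SFinite ν] {a : α → ℝ} (ha : Measurable a) :
    ∫⁻ s, ν {p | a p < s} ∂μ = ∫⁻ s, ν {p | a p ≤ s} ∂μ := by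
  have h1 : MeasurableSet {q : ℝ × α | a q.2 < q.1} :=
    measurableSet_lt (ha.comp measurable_snd) measurable_fst
  have h2 : MeasurableSet {q : ℝ × α | a q.2 ≤ q.1} :=
    measurableSet_le (ha.comp measurable_snd) measurable_fst
  have e1 := (Measure.prod_apply (μ := μ) (ν := ν) h1).symm.trans (Measure.prod_apply_symm h1)
  have e2 := (Measure.prod_apply (μ := μ) (ν := ν) h2).symm.trans (Measure.prod_apply_symm h2)
  refine e1.trans (Eq.trans ?_ e2.symm)
  exact lintegral_congr fun p => measure_congr (Ioi_ae_eq_Ici (a := a p))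

instance (n : ℕ) : NullSingletonClass (gammaLaw n) := by
  unfold gammaLaw; infer_instance

theorem integral_gammaLaw (n : ℕ) (g : ℝ → ℝ) :
    ∫ s, g s ∂gammaLaw n = ∫ s in Set.Ioi 0, gammaDensity n s * g s := by
  rw [gammaLaw, integral_withDensity_eq_integral_toReal_smul
    (continuous_gammaDensity n).measurable.ennreal_ofReal
    (ae_of_all _ fun s => ENNReal.ofReal_lt_top)]
  refine setIntegral_congr_fun measurableSet_Ioi fun s hs => ?_
  simp only [ENNReal.toReal_ofReal (gammaDensity_nonneg n (le_of_lt hs)), smul_eq_mul]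

theorem survival_succ_zero (c : ℝ) (N M : ℕ) : survival c (N + 1) M 0 = 1 := by
  rw [survival_eq _ _ _ le_rfl, Finset.sum_range_succ']
  simp [negBinomialTail]

theorem channelLaw_real_lt_zero {c : ℝ} (hc : 0 < c) (N M : ℕ) :
    (channelLaw (N + 1) M).real {p | 0 < channelForm c p} = 1 := by
  rw [measureReal_def, channelLaw_lt_channelForm hc]
  have h : ∀ᵐ s ∂gammaLaw N,
      channelLaw M N {p | 0 * (c * (1 + channelForm c p)) < s} = 1 := by
    have h0 : ∀ᵐ s ∂gammaLaw N, 0 < s :=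
      (withDensity_absolutelyContinuous _ _).ae_le (ae_restrict_mem measurableSet_Ioi)
    filter_upwards [h0] with s hs
    simp [hs]
  rw [lintegral_congr_ae h]
  simp

theorem channelLaw_real_le_of_lt {c y s : ℝ} (hc : 0 < c) (hy : 0 < y) (hs : s < c * y) {N M : ℕ} :
    (channelLaw N M).real {p | y * (c * (1 + channelForm c p)) ≤ s} = 0 := by
  have : {p : (Fin N → ℂ) × (Fin N × Fin M → ℂ) | y * (c * (1 + channelForm c p)) ≤ s} = ∅ := by
    refine Set.eq_empty_iff_forall_notMem.2 fun p hp => ?_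
    have hq := channelForm_nonneg hc p
    have hp' : y * (c * (1 + channelForm c p)) ≤ s := hp
    have : 0 ≤ y * (c * channelForm c p) := by positivity
    nlinarith
  rw [this, measureReal_empty]

theorem channelLaw_real_le_eq {c y s : ℝ} (hc : 0 < c) (hy : 0 < y) {N M : ℕ} :
    (channelLaw N M).real {p | y * (c * (1 + channelForm c p)) ≤ s} =
      1 - (channelLaw N M).real {p | s / (c * y) - 1 < channelForm c p} := by
  rw [← probReal_compl_eq_one_sub (measurableSet_lt measurable_const (measurable_channelForm hc N M))]
  congr 1
  ext p
  simp only [Set.mem_ofPred_eq, Set.mem_compl_iff, not_lt]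
  rw [le_sub_iff_add_le, le_div_iff₀ (by positivity)]
  ring_nf

theorem channelLaw_real_succ_lt {c y : ℝ} (hc : 0 < c) (hy : 0 < y) (N M : ℕ)
    (ih : ∀ q, 0 ≤ q → (channelLaw M N).real {p | q < channelForm c p} = survival c M N q) :
    (channelLaw (N + 1) M).real {p | y < channelForm c p} = survival c (N + 1) M y := by
  have hx : 0 < c * y := by positivity
  set G : ℝ → ℝ := fun s => (channelLaw M N).real {p | y * (c * (1 + channelForm c p)) ≤ s} with hG
  have hGmono : Monotone G := fun s t hst => measureReal_mono fun p hp => le_trans hp hst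
  have hGint : Integrable (fun s => gammaDensity N s * G s) (volume.restrict (Set.Ioi (c * y))) := by
    refine ((integrableOn_gammaDensity N).mono_set (Set.Ioi_subset_Ioi hx.le)).mul_bdd (c := 1)
      hGmono.measurable.aestronglyMeasurable (ae_of_all _ fun s => ?_)
    rw [Real.norm_eq_abs, abs_of_nonneg measureReal_nonneg]
    exact measureReal_le_one
  have hGeq : ∀ s ∈ Set.Ioi (c * y), gammaDensity N s * G s =
      gammaDensity N s - gammaDensity N s * survival c M N (s / (c * y) - 1) := by
    intro s hs
    have hs' : c * y < s := hs
    rw [hG]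
    simp only
    rw [channelLaw_real_le_eq hc hy, ih, mul_sub, mul_one]
    rw [sub_nonneg, le_div_iff₀ hx, one_mul]
    exact hs'.le
  have hden : IntegrableOn (gammaDensity N) (Set.Ioi (c * y)) :=
    (integrableOn_gammaDensity N).mono_set (Set.Ioi_subset_Ioi hx.le)
  have hsint : IntegrableOn (fun s => gammaDensity N s * survival c M N (s / (c * y) - 1))
      (Set.Ioi (c * y)) := by
    -- Integrability comes from the probabilistic side, where G is bounded by 1, so `survival` needs
    -- no estimate.
    refine (hden.sub hGint).congr ((ae_restrict_iff' measurableSet_Ioi).2 (ae_of_all _ fun s hs => ?_))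
    simp only [Pi.sub_apply]
    rw [hGeq s hs, sub_sub_cancel]
  have ha : Measurable fun p : (Fin M → ℂ) × (Fin M × Fin N → ℂ) =>
      y * (c * (1 + channelForm c p)) :=
    (((measurable_channelForm hc M N).const_add 1).const_mul c).const_mul y
  have hmono : Monotone fun s => channelLaw M N {p | y * (c * (1 + channelForm c p)) ≤ s} :=
    fun s t hst => measure_mono fun p hp => le_trans hp hst
  rw [measureReal_def, channelLaw_lt_channelForm hc, lintegral_measure_lt_eq_le _ _ ha,
    ← integral_toReal hmono.measurable.aemeasurable (ae_of_all _ fun s => measure_lt_top _ _)]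
  change ∫ s, G s ∂gammaLaw N = _
  -- Below cy the event is impossible because the form is nonnegative, so the integral starts at cy.
  rw [integral_gammaLaw, setIntegral_eq_of_subset_of_forall_sdiff_eq_zero measurableSet_Ioi
    (Set.Ici_subset_Ioi.2 hx), integral_Ici_eq_integral_Ioi,
    setIntegral_congr_fun measurableSet_Ioi hGeq, integral_sub hden hsint,
    survival_succ_eq hc hy]
  rintro s ⟨_, hs⟩
  have hs' : s < c * y := not_le.1 hs
  simp only [hG, channelLaw_real_le_of_lt hc hy hs', mul_zero]

/-- The survival function of the quadratic form `h† (K K† + c I)⁻¹ h` for independent `CN(0,1)`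
entries. -/
theorem channelLaw_real_lt {c : ℝ} (hc : 0 < c) (N M : ℕ) {y : ℝ} (hy : 0 ≤ y) :
    (channelLaw N M).real {p | y < channelForm c p} = survival c N M y := by
  -- The recursion exchanges the roles of N and M, so only their sum can serve as induction
  -- variable.
  induction h : N + M generalizing N M y with
  | zero =>
    obtain rfl : N = 0 := by omega
    have : ∀ p : (Fin 0 → ℂ) × (Fin 0 × Fin M → ℂ), channelForm c p = 0 := fun p => by
      simp [channelForm, gramForm]
    simp [this, survival, hy.not_gt]
  | succ n ih =>
    cases N with
    | zero =>
      have : ∀ p : (Fin 0 → ℂ) × (Fin 0 × Fin M → ℂ), channelForm c p = 0 := fun p => by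
        simp [channelForm, gramForm]
      simp [this, survival, hy.not_gt]
    | succ N =>
      -- The recursion step divides by cy, so y = 0 is separate; there both sides are 1.
      obtain rfl | hy' := hy.eq_or_lt
      · rw [channelLaw_real_lt_zero hc, survival_succ_zero]
      · exact channelLaw_real_succ_lt hc hy' N M fun q hq => ih M N hq (by omega)

/-! ### Matching with the stated formula -/

theorem negBinomialTail_of_le {M r : ℕ} (h : M ≤ r) (y : ℝ) : negBinomialTail M r y = 0 := by
  rw [negBinomialTail, Finset.sum_eq_zero, mul_zero]
  intro j hj
  rw [Nat.choose_eq_zero_of_lt (lt_of_lt_of_le (Finset.mem_range.1 hj) h), Nat.cast_zero, zero_mul]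

theorem upperIncompleteGamma_div_Gamma (n : ℕ) {x : ℝ} (hx : 0 ≤ x) :
    upperIncompleteGamma (n + 1 : ℕ) x / Real.Gamma (n + 1 : ℕ) =
      Real.exp (-x) * ∑ k ∈ Finset.range (n + 1), x ^ k / k.factorial := by
  rw [← integral_Ioi_gammaDensity n hx, upperIncompleteGamma, ← integral_div]
  push_cast
  simp only [Real.Gamma_nat_eq_factorial, add_sub_cancel_right, Real.rpow_natCast, gammaDensity]

/-- Here k = m-1, r = N-m and d = M-r-1; the gamma factors other than Γ(m) combine to C(M, r+1). -/
theorem hypergeometric_term_eq {k r d : ℕ} {x ρ : ℝ} (hx : 0 ≤ ρ * x) :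
    Real.Gamma ((r + 1 + d : ℕ) + 1) * x ^ (k + 1 + r) *
      (ρ ^ (r + 1) * gaussHypergeometric ((r + 1 + d : ℕ) + 1) (r + 1) (r + 2) (-(ρ * x)) /
        (Real.Gamma ((k + 1 : ℕ)) * Real.Gamma (r + 2) * Real.Gamma (d + 1))) =
      x ^ k / k.factorial * negBinomialTail (r + 1 + d) r (ρ * x) := by
  rw [← gaussHypergeometric_mul_eq_negBinomialTail (by omega) hx,
    Nat.cast_choose ℝ (by omega : r + 1 ≤ r + 1 + d), Nat.add_sub_cancel_left]
  have e1 : ((r : ℝ) + 2) = ((r + 1 : ℕ) : ℝ) + 1 := by push_cast; ring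
  have e2 : Real.Gamma ((r : ℝ) + 2) = (r + 1).factorial := by
    rw [e1, Real.Gamma_nat_eq_factorial]
  have e3 : Real.Gamma ((k + 1 : ℕ) : ℝ) = k.factorial := by
    rw [Nat.cast_succ, Real.Gamma_nat_eq_factorial]
  rw [e2, e3, Real.Gamma_nat_eq_factorial, Real.Gamma_nat_eq_factorial, mul_pow]
  field_simp
  ring

theorem one_sub_survival_eq {N M : ℕ} (hN : 1 ≤ N) {ρ x : ℝ} (hρ : 0 < ρ) (hx : 0 ≤ x) :
    1 - survival (1 / ρ) N M (ρ * x) =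
      1 - upperIncompleteGamma N x / Real.Gamma N
          + Real.Gamma (M + 1) * Real.exp (-x) * x ^ N *
            ∑ m ∈ Finset.Icc (max 0 (N - M) + 1) N,
              ρ ^ (N - m + 1) *
                gaussHypergeometric (M + 1) (N - m + 1) (N - m + 2) (-(ρ * x)) /
                (Real.Gamma m * Real.Gamma (N - m + 2) * Real.Gamma (m - N + M)) := by
  have hy : 0 ≤ ρ * x := by positivity
  obtain ⟨n, rfl⟩ := Nat.exists_eq_add_of_le' hN
  have hsum : Real.Gamma (M + 1) * x ^ (n + 1) *
      ∑ m ∈ Finset.Icc (max 0 (n + 1 - M) + 1) (n + 1),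
              ρ ^ (n + 1 - m + 1) *
                gaussHypergeometric (M + 1) ((n + 1 : ℕ) - m + 1) ((n + 1 : ℕ) - m + 2) (-(ρ * x)) /
                (Real.Gamma m * Real.Gamma ((n + 1 : ℕ) - m + 2) *
                  Real.Gamma (m - (n + 1 : ℕ) + M)) =
      ∑ k ∈ Finset.range (n + 1), x ^ k / k.factorial * negBinomialTail M (n - k) (ρ * x) := by
    -- For k < n+1-M the tail asks for more than M successes and vanishes; this is the origin of m₁.
    -- The truncated subtraction already gives the maximum with 0.
    have hsub : Finset.Ico (n + 1 - M) (n + 1) ⊆ Finset.range (n + 1) := by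
      intro k; simp only [Finset.mem_Ico, Finset.mem_range]; omega
    rw [← Finset.sum_subset hsub, Finset.mul_sum]
    · refine Finset.sum_nbij' (fun m => m - 1) (fun k => k + 1) ?_ ?_ ?_ ?_ ?_
      · intro m; simp only [Finset.mem_Icc, Finset.mem_Ico]; omega
      · intro m; simp only [Finset.mem_Icc, Finset.mem_Ico]; omega
      · intro m; simp only [Finset.mem_Icc]; omega
      · intro m; simp
      · intro m hm
        rw [Finset.mem_Icc] at hm
        obtain ⟨k, rfl⟩ := Nat.exists_eq_add_of_le' (show 1 ≤ m by omega)
        obtain ⟨r, rfl⟩ := Nat.exists_eq_add_of_le (show k ≤ n by omega)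
        obtain ⟨d, rfl⟩ := Nat.exists_eq_add_of_le (show r + 1 ≤ M by omega)
        rw [show k + r + 1 - (k + 1) + 1 = r + 1 by omega, show k + 1 - 1 = k by omega,
          show k + r - k = r by omega, show k + r + 1 = k + 1 + r by omega]
        have e1 : (((k + 1 + r : ℕ) : ℝ) - ((k + 1 : ℕ) : ℝ)) = r := by push_cast; ring
        have e2 : (((k + 1 : ℕ) : ℝ) - ((k + 1 + r : ℕ) : ℝ)) + ((r + 1 + d : ℕ) : ℝ) = d + 1 := by
          push_cast; ring
        rw [e1, e2, hypergeometric_term_eq hy]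
    · intro k hk hk'
      rw [Finset.mem_range] at hk
      rw [Finset.mem_Ico] at hk'
      rw [negBinomialTail_of_le (by omega), mul_zero]
  have hc : 1 / ρ * (ρ * x) = x := by field_simp
  rw [upperIncompleteGamma_div_Gamma n hx, survival_eq _ _ _ hy, hc, mul_right_comm (Real.Gamma _),
    mul_right_comm _ (Real.exp (-x)), hsum]
  simp only [Nat.add_sub_cancel, mul_sub, mul_one, Finset.sum_sub_distrib]
  ring

/-! ### Joint law of the channels and conclusion -/

theorem hasLaw_channelLaw {Ω : Type*} [MeasurableSpace Ω] {P : Measure Ω} [IsProbabilityMeasure P]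
    {N M : ℕ} {h1 : Fin N → Ω → ℂ} {HI : Fin N → Fin M → Ω → ℂ}
    (hlaw1 : ∀ n, HasLaw (h1 n) complexGaussian P)
    (hlawI : ∀ n i, HasLaw (HI n i) complexGaussian P)
    (hindep : iIndepFun (Sum.elim h1 (fun p : Fin N × Fin M => HI p.1 p.2)) P) :
    HasLaw (fun ω => ((fun n => h1 n ω, fun p => HI p.1 p.2 ω) :
      (Fin N → ℂ) × (Fin N × Fin M → ℂ))) (channelLaw N M) P := by
  have hlaw : ∀ i, HasLaw (Sum.elim h1 (fun p : Fin N × Fin M => HI p.1 p.2) i)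
      complexGaussian P := by
    rintro (n | p)
    · exact hlaw1 n
    · exact hlawI p.1 p.2
  have hm := (iIndepFun_iff_map_fun_eq_pi_map fun i => (hlaw i).aemeasurable).1 hindep
  simp only [(hlaw _).map_eq] at hm
  have hL : HasLaw (fun ω i => Sum.elim h1 (fun p : Fin N × Fin M => HI p.1 p.2) i ω)
      (gaussianFamily (Fin N ⊕ Fin N × Fin M)) P :=
    ⟨aemeasurable_pi_lambda _ fun i => (hlaw i).aemeasurable, hm⟩
  have hS := measurePreserving_sumPiEquivProdPi
    (fun _ : Fin N ⊕ Fin N × Fin M => complexGaussian)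
  exact HasLaw.comp (hS.hasLaw) hL

end

theorem proposition2 {Ω : Type*} [MeasurableSpace Ω] (P : Measure Ω) [IsProbabilityMeasure P]
    (N M : ℕ) (hN : 1 ≤ N) (ρ1 ρI : ℝ) (hρ1 : 0 < ρ1) (hρI : 0 < ρI)
    (h1 : Fin N → Ω → ℂ) (HI : Fin N → Fin M → Ω → ℂ)
    (hlaw1 : ∀ n, HasLaw (h1 n) complexGaussian P)
    (hlawI : ∀ n i, HasLaw (HI n i) complexGaussian P)
    (hindep : iIndepFun (Sum.elim h1 (fun p : Fin N × Fin M => HI p.1 p.2)) P)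
    (Z : Ω → ℝ)
    (hZ : ∀ ω, Z ω = mmseSINR ρ1 ρI (fun n => h1 n ω) (Matrix.of fun n i => HI n i ω)) :
    AEMeasurable Z P ∧
    (∀ ω, (Z ω : ℂ) = ((ρ1 / ρI : ℝ) : ℂ) *
      (star (fun n => h1 n ω) ⬝ᵥ
        ((interferenceMatrix ρI (Matrix.of fun n i => HI n i ω))⁻¹ *ᵥ (fun n => h1 n ω)))) ∧
    (∀ z : ℝ, z < 0 → cdf (P.map Z) z = 0) ∧
    (∀ z : ℝ, 0 ≤ z →
      cdf (P.map Z) z =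
        1 - upperIncompleteGamma N (z / ρ1) / Real.Gamma N
          + Real.Gamma (M + 1) * Real.exp (-(z / ρ1)) * (z / ρ1) ^ N *
            ∑ m ∈ Finset.Icc (max 0 (N - M) + 1) N,
              ρI ^ (N - m + 1) *
                gaussHypergeometric (M + 1) (N - m + 1) (N - m + 2) (-(ρI / ρ1 * z)) /
                (Real.Gamma m * Real.Gamma (N - m + 2) * Real.Gamma (m - N + M))) := by
  have hc : 0 < 1 / ρI := by positivity
  have hW := hasLaw_channelLaw hlaw1 hlawI hindep
  have hZW : ∀ ω, Z ω = ρ1 / ρI * channelForm (1 / ρI)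
      ((fun n => h1 n ω, fun p => HI p.1 p.2 ω) : (Fin N → ℂ) × (Fin N × Fin M → ℂ)) := fun ω => by
    rw [hZ, mmseSINR_eq ρ1 hρI]
    rfl
  have hmeas := measurable_channelForm hc N M
  have hZm : AEMeasurable Z P := by
    rw [funext hZW]
    exact (hmeas.comp_aemeasurable hW.aemeasurable).const_mul _
  have : IsProbabilityMeasure (P.map Z) := Measure.isProbabilityMeasure_map hZm
  have hcdf : ∀ z, cdf (P.map Z) z =
      1 - (channelLaw N M).real {p | ρI * (z / ρ1) < channelForm (1 / ρI) p} := by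
    intro z
    rw [cdf_eq_real, map_measureReal_apply_of_aemeasurable hZm measurableSet_Iic,
      ← probReal_compl_eq_one_sub (measurableSet_lt measurable_const hmeas)]
    refine Eq.trans ?_ (hW.measureReal_eq
      (p := fun p => ¬ ρI * (z / ρ1) < channelForm (1 / ρI) p)
      (measurableSet_lt measurable_const hmeas).compl)
    congr 1
    ext ω
    simp only [Set.mem_preimage, Set.mem_Iic, Set.mem_ofPred_eq, not_lt]
    rw [hZW, div_mul_eq_mul_div, div_le_iff₀ hρI, mul_div_assoc', le_div_iff₀ hρ1]
    ring_nf
  refine ⟨hZm, fun ω => ?_, fun z hz => ?_, fun z hz => ?_⟩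
  · rw [hZ, mmseSINR_eq ρ1 hρI, Complex.ofReal_mul, ofReal_gramForm]
    rfl
  · have hneg : ρI * (z / ρ1) < 0 := mul_neg_of_pos_of_neg hρI (div_neg_of_neg_of_pos hz hρ1)
    rw [hcdf]
    have : {p : (Fin N → ℂ) × (Fin N × Fin M → ℂ) | ρI * (z / ρ1) < channelForm (1 / ρI) p} =
        Set.univ :=
      Set.eq_univ_of_forall fun p => hneg.trans_le (channelForm_nonneg hc p)
    rw [this, probReal_univ, sub_self]
  · have hx : 0 ≤ z / ρ1 := by positivity
    have hy : ρI / ρ1 * z = ρI * (z / ρ1) := by ring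
    rw [hcdf, channelLaw_real_lt hc N M (by positivity), hy]
    exact one_sub_survival_eq hN hρI hx
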